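/- All Hilbert spaces are finite-dimensional complex Hilbert spaces. For a system $A$ let $\mathcal S_\bullet(A)$ be the set of positive semi-definite operators $\rho$ on $\mathcal H_A$ with $\operatorname{tr}\rho\le 1$ (sub-normalized states); such a $\rho$ is pure if it has rank one. Let $\log$ be the logarithm to a fixed base greater than $1$, $\exp$ its inverse, and $\log 0=-\infty$. For positive semi-definite $\rho,\tau$ the fidelity is $F(\rho,\tau)=\big(\operatorname{tr}|\sqrt\rho\sqrt\tau|\big)^2$. For $\rho,\tau\in\mathcal S_\bullet(A)$ the generalized fidelity is $$F_*(\rho,\tau)=\Big(\operatorname{tr}|\sqrt\rho\sqrt\tau|+\sqrt{(1-\operatorname{tr}\rho)(1-\operatorname{tr}\tau)}\Big)^2 ,$$ the purified distance is $P(\rho,\tau)=\sqrt{1-F_*(\rho,\tau)}$, and $\mathcal B^\varepsilon(\rho)=\{\tau\in\mathcal S_\bullet(A): P(\tau,\rho)\le\varepsilon\}$. For $\rho_{AB}\in\mathcal S_\bullet(AB)$ put $$H_{\min}(A|B)_\rho=\sup_{\sigma_B\in\mathcal S_\bullet(B)}\sup\{\lambda\in\mathbb R:\rho_{AB}\le\exp(-\lambda)\,\mathrm{id}_A\otimes\sigma_B\},\qquad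 H_{\max}(A|B)_\rho=\sup_{\sigma_B\in\mathcal S_\bullet(B)}\log F(\rho_{AB},\mathrm{id}_A\otimes\sigma_B),$$ and define the smooth entropies by $$H_{\min}^{\varepsilon}(A|B)_\rho=\max_{\tilde\rho\in\mathcal B^\varepsilon(\rho_{AB})}H_{\min}(A|B)_{\tilde\rho},\qquad H_{\max}^{\varepsilon}(A|B)_\rho=\min_{\tilde\rho\in\mathcal B^\varepsilon(\rho_{AB})}H_{\max}(A|B)_{\tilde\rho}.$$ Proposition. Let $\rho_{ABC}\in\mathcal S_\bullet(ABC)$ be pure, with marginals $\rho_{AB}=\operatorname{tr}_C\rho_{ABC}$ and $\rho_{AC}=\operatorname{tr}_B\rho_{ABC}$, and let $0\le\varepsilon<\sqrt{\operatorname{tr}\rho_{ABC}}$. Then the minimum defining $H_{\max}^{\varepsilon}(A|B)_\rho$ and the maximum defining $H_{\min}^{\varepsilon}(A|C)_\rho$ are attained and finite, and $$H_{\max}^{\varepsilon}(A|B)_\rho=-H_{\min}^{\varepsilon}(A|C)_\rho .$$ -/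

import Mathlib

open scoped Matrix Kronecker ComplexOrder MatrixOrder

/-! A finite-dimensional quantum system is represented by the finite index set of an orthonormal
basis of its Hilbert space; operators are complex matrices, `A × B` indexes the product basis of the
tensor product, and `≤` between matrices is the Loewner order. -/

namespace SmoothEntropy

noncomputable section

/-- Sub-normalized density operators: positive semi-definite with trace at most one. -/
def SubNormalized {A : Type*} [Fintype A] : Set (Matrix A A ℂ) :=
  {ρ | ρ.PosSemidef ∧ ρ.trace.re ≤ 1}

/-- Pure (sub-normalized) states are those of rank one. -/
def IsPure {A : Type*} [Fintype A] (ρ : Matrix A A ℂ) : Prop :=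
  ρ ∈ SubNormalized ∧ ρ.rank = 1

/-- The marginal on `AB` (the partial trace over `C`) of an operator on `ABC`. -/
def marginalAB {A B C : Type*} [Fintype C]
    (ρ : Matrix (A × B × C) (A × B × C) ℂ) : Matrix (A × B) (A × B) ℂ :=
  Matrix.of fun i j => ∑ c, ρ (i.1, i.2, c) (j.1, j.2, c)

/-- The marginal on `AC` (the partial trace over `B`) of an operator on `ABC`. -/
def marginalAC {A B C : Type*} [Fintype B]
    (ρ : Matrix (A × B × C) (A × B × C) ℂ) : Matrix (A × C) (A × C) ℂ :=
  Matrix.of fun i j => ∑ b, ρ (i.1, b, i.2) (j.1, b, j.2)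

/-- `tr |√ρ √τ|`, the square root of the fidelity. Here `|L| = √(L† L)`. -/
def rootFidelity {A : Type*} [Fintype A] [DecidableEq A] (ρ τ : Matrix A A ℂ) : ℝ :=
  (CFC.abs (CFC.sqrt ρ * CFC.sqrt τ)).trace.re

/-- The fidelity `F(ρ, τ) = (tr |√ρ √τ|)²` of positive semi-definite operators. -/
def fidelity {A : Type*} [Fintype A] [DecidableEq A] (ρ τ : Matrix A A ℂ) : ℝ :=
  rootFidelity ρ τ ^ 2

/-- The generalized fidelity of sub-normalized states. -/
def genFidelity {A : Type*} [Fintype A] [DecidableEq A] (ρ τ : Matrix A A ℂ) : ℝ :=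
  (rootFidelity ρ τ + √((1 - ρ.trace.re) * (1 - τ.trace.re))) ^ 2

/-- The purified distance of sub-normalized states. -/
def purifiedDistance {A : Type*} [Fintype A] [DecidableEq A] (ρ τ : Matrix A A ℂ) : ℝ :=
  √(1 - genFidelity ρ τ)

/-- The `ε`-ball of sub-normalized states around `ρ` in purified distance. -/
def ball {A : Type*} [Fintype A] [DecidableEq A] (ε : ℝ) (ρ : Matrix A A ℂ) :
    Set (Matrix A A ℂ) :=
  {τ | τ ∈ SubNormalized ∧ purifiedDistance τ ρ ≤ ε}

/-- The logarithm to base `b` of a nonnegative real, with `log 0 = -∞`. -/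
def elog (b x : ℝ) : EReal :=
  if x = 0 then ⊥ else ((Real.logb b x : ℝ) : EReal)

/-- The conditional min-entropy `H_min(A|B)_ρ`, with logarithm and exponential to base `b`. -/
def Hmin {A B : Type*} [Fintype A] [Fintype B] [DecidableEq A] (b : ℝ)
    (ρ : Matrix (A × B) (A × B) ℂ) : EReal :=
  ⨆ σ ∈ (SubNormalized : Set (Matrix B B ℂ)),
    ⨆ l ∈ {l : ℝ | ρ ≤ (b ^ (-l)) • ((1 : Matrix A A ℂ) ⊗ₖ σ)}, (l : EReal)

/-- The conditional max-entropy `H_max(A|B)_ρ`, with logarithm to base `b`. -/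
def Hmax {A B : Type*} [Fintype A] [Fintype B] [DecidableEq A] [DecidableEq B] (b : ℝ)
    (ρ : Matrix (A × B) (A × B) ℂ) : EReal :=
  ⨆ σ ∈ (SubNormalized : Set (Matrix B B ℂ)), elog b (fidelity ρ ((1 : Matrix A A ℂ) ⊗ₖ σ))

/-- The `ε`-smooth conditional min-entropy. -/
def smoothHmin {A B : Type*} [Fintype A] [Fintype B] [DecidableEq A] [DecidableEq B] (b ε : ℝ)
    (ρ : Matrix (A × B) (A × B) ℂ) : EReal :=
  ⨆ τ ∈ ball ε ρ, Hmin b τ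

/-- The `ε`-smooth conditional max-entropy. -/
def smoothHmax {A B : Type*} [Fintype A] [Fintype B] [DecidableEq A] [DecidableEq B] (b ε : ℝ)
    (ρ : Matrix (A × B) (A × B) ℂ) : EReal :=
  ⨅ τ ∈ ball ε ρ, Hmax b τ

end

end SmoothEntropy

/-! Write the pure state as `vecMulVec ψ (star ψ)` and read `ψ` as `M : C → AB` and as `N : B → AC`;
the marginals are `M * Mᴴ` and `N * Nᴴ`.

Without smoothing, the root fidelity of `M * Mᴴ` and `S * Sᴴ` is the maximum of `Re tr (W * Mᴴ * S)`
over contractions `W`. For `S = 1 ⊗ s` this trace regroups to `tr (Nᴴ * K * sᵀ)`, where `K` holds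
the entries of `W` and `W` is a contraction iff `tr_A (K * Kᴴ) ≤ 1`. Cauchy–Schwarz then bounds the
fidelity by `tr ω` whenever `N * Nᴴ ≤ 1 ⊗ ω` (`fidelity_le_trace`). Conversely, if no such `ω` has
trace at most `q`, a separating functional yields `W` and `σ` with fidelity above `q`
(`exists_lt_fidelity`).

For smoothing, both balls are replaced by one compact set of vectors, `vectorBall ε ψ`. By a form of
Uhlmann's theorem (`exists_trace_le_of_mem_ball`), each `τ` in a ball dominates the marginal of a
vector in this set. Passing to that marginal does not lower `Hmin` and does not raise `Hmax`, so
both optima may be taken over the same vectors, where the unsmoothed duality applies. Compactness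
gives attainment; `ε < √(tr ρ)` excludes the zero vector and gives finiteness. -/

namespace SmoothEntropy

open Matrix

/-! ### Contractions and factorizations of positive operators -/

section Contraction

variable {k l m n : Type*} [Fintype k] [Fintype l] [Fintype m] [Fintype n]

/-- Rectangular matrices of operator norm at most one. -/
def IsContraction [DecidableEq n] (W : Matrix m n ℂ) : Prop :=
  Wᴴ * W ≤ 1

lemma conjTranspose_mul_mul_mono {A B : Matrix n n ℂ} (h : A ≤ B) (X : Matrix n m ℂ) :
    Xᴴ * A * X ≤ Xᴴ * B * X := by
  rw [Matrix.le_iff] at h ⊢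
  have := h.conjTranspose_mul_mul_same X
  rwa [Matrix.mul_sub, Matrix.sub_mul] at this

lemma mul_mul_conjTranspose_mono {A B : Matrix n n ℂ} (h : A ≤ B) (X : Matrix m n ℂ) :
    X * A * Xᴴ ≤ X * B * Xᴴ := by
  simpa using conjTranspose_mul_mul_mono h Xᴴ

lemma IsContraction.mul [DecidableEq n] [DecidableEq m] {V : Matrix l m ℂ} {W : Matrix m n ℂ}
    (hV : IsContraction V) (hW : IsContraction W) : IsContraction (V * W) := by
  have h := conjTranspose_mul_mul_mono hV W
  rw [Matrix.mul_one] at h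
  have h' : (V * W)ᴴ * (V * W) = Wᴴ * (Vᴴ * V) * W := by
    simp only [conjTranspose_mul, Matrix.mul_assoc]
  exact (h'.trans_le h).trans hW

/-- This rests on `1 - Q = (1 - Q)² + (Q - Q²)`, a sum of two positive terms. -/
lemma le_one_of_mul_self_le [DecidableEq n] {Q : Matrix n n ℂ} (hQ : Q.IsHermitian)
    (h : Q * Q ≤ Q) : Q ≤ 1 := by
  rw [Matrix.le_iff] at h ⊢
  have h1 := posSemidef_conjTranspose_mul_self (1 - Q)
  have h2 : 1 - Q = (1 - Q)ᴴ * (1 - Q) + (Q - Q * Q) := by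
    rw [conjTranspose_sub, conjTranspose_one, hQ.eq]
    noncomm_ring
  rw [h2]
  exact h1.add h

lemma IsContraction.conjTranspose [DecidableEq n] [DecidableEq m] {W : Matrix m n ℂ}
    (hW : IsContraction W) : IsContraction Wᴴ := by
  have h := mul_mul_conjTranspose_mono hW W
  rw [Matrix.mul_one] at h
  unfold IsContraction
  rw [conjTranspose_conjTranspose]
  refine le_one_of_mul_self_le (isHermitian_mul_conjTranspose_self W) ?_
  simpa only [Matrix.mul_assoc] using h

lemma isContraction_one [DecidableEq n] : IsContraction (1 : Matrix n n ℂ) := by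
  simp [IsContraction]

lemma trace_mul_re_nonneg [DecidableEq n] {A P : Matrix n n ℂ} (hA : 0 ≤ A) (hP : 0 ≤ P) :
    0 ≤ (A * P).trace.re := by
  obtain ⟨R, rfl⟩ := CStarAlgebra.nonneg_iff_eq_star_mul_self.mp hP
  rw [star_eq_conjTranspose, ← Matrix.mul_assoc, trace_mul_comm, ← Matrix.mul_assoc]
  exact (Complex.le_def.mp (hA.posSemidef.mul_mul_conjTranspose_same R).trace_nonneg).1

lemma trace_mul_re_mono [DecidableEq n] {A B P : Matrix n n ℂ} (h : A ≤ B) (hP : 0 ≤ P) :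
    (A * P).trace.re ≤ (B * P).trace.re := by
  have := trace_mul_re_nonneg (sub_nonneg.mpr h) hP
  rw [Matrix.sub_mul, trace_sub, Complex.sub_re] at this
  linarith

lemma trace_re_mono [DecidableEq n] {A B : Matrix n n ℂ} (h : A ≤ B) :
    A.trace.re ≤ B.trace.re := by
  simpa using trace_mul_re_mono h (zero_le_one : (0 : Matrix n n ℂ) ≤ 1)

lemma trace_re_nonneg {A : Matrix n n ℂ} (h : 0 ≤ A) : 0 ≤ A.trace.re :=
  (Complex.le_def.mp h.posSemidef.trace_nonneg).1

/-- Only the Hermitian part of `V` contributes, and `2 - V - Vᴴ = (1 - V)ᴴ(1 - V) + (1 - VᴴV)` is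
positive. -/
lemma trace_contraction_mul_re_le [DecidableEq n] {V P : Matrix n n ℂ} (hV : IsContraction V)
    (hP : 0 ≤ P) : (V * P).trace.re ≤ P.trace.re := by
  have h1 : V + Vᴴ ≤ (2 : ℂ) • (1 : Matrix n n ℂ) := by
    have h2 := posSemidef_conjTranspose_mul_self (1 - V)
    rw [Matrix.le_iff]
    have h3 : (2 : ℂ) • (1 : Matrix n n ℂ) - (V + Vᴴ)
        = (1 - V)ᴴ * (1 - V) + (1 - Vᴴ * V) := by
      rw [conjTranspose_sub, conjTranspose_one, two_smul]
      noncomm_ring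
    rw [h3]
    exact h2.add hV
  have h4 := trace_mul_re_mono h1 hP
  have h5 : (Vᴴ * P).trace.re = (V * P).trace.re := by
    rw [trace_mul_comm V P, ← Complex.conj_re (trace (P * V))]
    change _ = (star (trace (P * V))).re
    rw [← trace_conjTranspose, conjTranspose_mul, hP.posSemidef.isHermitian.eq]
  rw [Matrix.add_mul, trace_add, Complex.add_re, h5, smul_mul_assoc, trace_smul,
    Matrix.one_mul] at h4
  simp at h4
  linarith

/-- A Hermitian matrix has a Hermitian generalized inverse. -/
lemma exists_hermitian_generalized_inverse [DecidableEq n] {Q : Matrix n n ℂ}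
    (hQs : Q.IsHermitian) : ∃ T : Matrix n n ℂ, Tᴴ = T ∧ Q * T * Q = Q := by
  have hQs' : IsSelfAdjoint Q := hQs
  have hfin : ∀ f : ℝ → ℝ, ContinuousOn f (spectrum ℝ Q) := fun f =>
    (Matrix.finite_real_spectrum (A := Q)).continuousOn f
  have hQid : cfc (fun x : ℝ => x) Q = Q := cfc_id' ℝ Q
  -- With `0⁻¹ = 0`, the identity `x * x⁻¹ * x = x` holds on the whole spectrum, including at zero.
  refine ⟨cfc (fun x : ℝ => x⁻¹) Q,
    (cfc_predicate (fun x : ℝ => x⁻¹) Q : IsSelfAdjoint _), ?_⟩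
  conv_rhs => rw [← hQid]
  nth_rewrite 1 3 [← hQid]
  rw [← cfc_mul _ _ Q (hfin _) (hfin _), ← cfc_mul _ _ Q (hfin _) (hfin _)]
  congr 1
  ext x
  by_cases hx : x = 0 <;> simp [hx]

lemma generalized_inverse_mul_factor {Q T : Matrix n n ℂ} (hQs : Q.IsHermitian) (hTs : Tᴴ = T)
    (hQTQ : Q * T * Q = Q) {X : Matrix n m ℂ} (hX : X * Xᴴ = Q) : Q * T * X = X := by
  have h0 : (X - Q * T * X) * (X - Q * T * X)ᴴ = 0 := by
    have e : (X - Q * T * X) * (X - Q * T * X)ᴴ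
        = X * Xᴴ - (X * Xᴴ) * T * Q - (Q * T * (X * Xᴴ) - Q * T * (X * Xᴴ) * T * Q) := by
      simp only [conjTranspose_sub, conjTranspose_mul, hTs, hQs.eq,
        Matrix.mul_sub, Matrix.sub_mul, Matrix.mul_assoc]
      abel
    rw [e, hX, hQTQ, hQTQ]
    simp
  exact (sub_eq_zero.mp (self_mul_conjTranspose_eq_zero.mp h0)).symm

/-- Two factorizations of the same positive operator differ by a contraction. -/
lemma exists_contraction_of_mul_conjTranspose_eq [DecidableEq l] [DecidableEq m] [DecidableEq n]
    {M : Matrix n m ℂ} {N : Matrix n l ℂ} (h : M * Mᴴ = N * Nᴴ) :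
    ∃ U : Matrix l m ℂ, IsContraction U ∧ M = N * U ∧ N = M * Uᴴ := by
  set Q := N * Nᴴ with hQ
  have hQs : Q.IsHermitian := isHermitian_mul_conjTranspose_self N
  obtain ⟨T, hTs, hQTQ⟩ := exists_hermitian_generalized_inverse hQs
  have hM : Q * T * M = M := generalized_inverse_mul_factor hQs hTs hQTQ h
  have hN : Q * T * N = N := generalized_inverse_mul_factor hQs hTs hQTQ hQ.symm
  -- This is a partial isometry: `Uᴴ * U = Mᴴ * T * M` is Hermitian and idempotent.
  refine ⟨Nᴴ * T * M, ?_, ?_, ?_⟩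
  · have e : (Nᴴ * T * M)ᴴ * (Nᴴ * T * M) = Mᴴ * T * M := by
      calc (Nᴴ * T * M)ᴴ * (Nᴴ * T * M) = Mᴴ * T * (Q * T * M) := by
            simp only [conjTranspose_mul, hTs, conjTranspose_conjTranspose, Matrix.mul_assoc, hQ]
        _ = Mᴴ * T * M := by rw [hM]
    unfold IsContraction
    rw [e]
    refine le_one_of_mul_self_le ?_ (le_of_eq ?_)
    · rw [Matrix.IsHermitian]
      simp only [conjTranspose_mul, hTs, conjTranspose_conjTranspose, Matrix.mul_assoc]
    · calc Mᴴ * T * M * (Mᴴ * T * M) = Mᴴ * T * ((M * Mᴴ) * T * M) := by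
            simp only [Matrix.mul_assoc]
        _ = Mᴴ * T * M := by rw [h, hM]
  · rw [← Matrix.mul_assoc, ← Matrix.mul_assoc, ← hQ, hM]
  · rw [conjTranspose_mul, conjTranspose_mul, hTs, conjTranspose_conjTranspose,
      ← Matrix.mul_assoc, ← Matrix.mul_assoc, h, hN]

end Contraction

/-! ### Variational formula for the root fidelity -/

section Fidelity

variable {k l m n : Type*} [Fintype k] [Fintype l] [Fintype m] [Fintype n]
  [DecidableEq k] [DecidableEq l] [DecidableEq m] [DecidableEq n]

lemma sqrt_conjTranspose (A : Matrix n n ℂ) : (CFC.sqrt A)ᴴ = CFC.sqrt A :=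
  (CFC.sqrt_nonneg A).posSemidef.isHermitian

lemma sqrt_mul_conjTranspose {A : Matrix n n ℂ} (hA : 0 ≤ A) :
    CFC.sqrt A * (CFC.sqrt A)ᴴ = A := by
  rw [sqrt_conjTranspose, CFC.sqrt_mul_sqrt_self A hA]

/-- Polar decomposition. -/
lemma exists_polar (L : Matrix n n ℂ) :
    ∃ U : Matrix n n ℂ, IsContraction U ∧ Lᴴ = CFC.abs L * U ∧ CFC.abs L = Lᴴ * Uᴴ := by
  refine exists_contraction_of_mul_conjTranspose_eq ?_
  rw [(CFC.abs_nonneg L).posSemidef.isHermitian.eq, CFC.abs_mul_abs, conjTranspose_conjTranspose]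
  rfl

lemma trace_mul_re_le_trace_abs {W L : Matrix n n ℂ} (hW : IsContraction W) :
    (W * L).trace.re ≤ (CFC.abs L).trace.re := by
  obtain ⟨U, hU, h1, -⟩ := exists_polar L
  have h2 : L = Uᴴ * CFC.abs L := by
    have h3 := congrArg Matrix.conjTranspose h1
    rwa [conjTranspose_conjTranspose, conjTranspose_mul,
      (CFC.abs_nonneg L).posSemidef.isHermitian.eq] at h3
  conv_lhs => rw [h2]
  rw [← Matrix.mul_assoc]
  exact trace_contraction_mul_re_le (hW.mul hU.conjTranspose) (CFC.abs_nonneg L)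

lemma exists_trace_mul_eq_trace_abs (L : Matrix n n ℂ) :
    ∃ U : Matrix n n ℂ, IsContraction U ∧ (U * L).trace.re = (CFC.abs L).trace.re := by
  obtain ⟨U, hU, -, h1⟩ := exists_polar L
  refine ⟨U, hU, ?_⟩
  have h2 : CFC.abs L = U * L := by
    rw [← (CFC.abs_nonneg L).posSemidef.isHermitian.eq, h1, conjTranspose_mul,
      conjTranspose_conjTranspose, conjTranspose_conjTranspose]
  rw [← h2]

/-- Arbitrary factors differ from the square roots by contractions, which are absorbed into `W`.
Together with `exists_trace_mul_eq_rootFidelity` this makes the root fidelity a maximum over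
contractions, for any choice of factors. -/
lemma trace_mul_re_le_rootFidelity {W : Matrix k m ℂ} (hW : IsContraction W)
    (M : Matrix n m ℂ) (S : Matrix n k ℂ) :
    (W * Mᴴ * S).trace.re ≤ rootFidelity (M * Mᴴ) (S * Sᴴ) := by
  obtain ⟨U, hU, h1, -⟩ := exists_contraction_of_mul_conjTranspose_eq (M := M)
    (sqrt_mul_conjTranspose (posSemidef_self_mul_conjTranspose M).nonneg).symm
  obtain ⟨V, hV, h2, -⟩ := exists_contraction_of_mul_conjTranspose_eq (M := S)
    (sqrt_mul_conjTranspose (posSemidef_self_mul_conjTranspose S).nonneg).symm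
  have h3 := trace_mul_re_le_trace_abs (L := CFC.sqrt (M * Mᴴ) * CFC.sqrt (S * Sᴴ))
    ((hV.mul hW).mul hU.conjTranspose)
  refine le_trans (le_of_eq ?_) h3
  generalize hX : CFC.sqrt (M * Mᴴ) = X at *
  generalize CFC.sqrt (S * Sᴴ) = Y at *
  have hXh : Xᴴ = X := hX ▸ sqrt_conjTranspose _
  have h4 : W * Mᴴ * S = W * Uᴴ * (X * Y) * V := by
    rw [h1, h2, conjTranspose_mul, hXh]
    simp only [Matrix.mul_assoc]
  rw [h4, trace_mul_comm]
  simp only [Matrix.mul_assoc]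

lemma exists_trace_mul_eq_rootFidelity (M : Matrix n m ℂ) (S : Matrix n k ℂ) :
    ∃ W : Matrix k m ℂ, IsContraction W ∧
      (W * Mᴴ * S).trace.re = rootFidelity (M * Mᴴ) (S * Sᴴ) := by
  obtain ⟨U, hU, -, h1⟩ := exists_contraction_of_mul_conjTranspose_eq (M := M)
    (sqrt_mul_conjTranspose (posSemidef_self_mul_conjTranspose M).nonneg).symm
  obtain ⟨V, hV, -, h2⟩ := exists_contraction_of_mul_conjTranspose_eq (M := S)
    (sqrt_mul_conjTranspose (posSemidef_self_mul_conjTranspose S).nonneg).symm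
  obtain ⟨T, hT, h3⟩ := exists_trace_mul_eq_trace_abs
    (CFC.sqrt (M * Mᴴ) * CFC.sqrt (S * Sᴴ))
  refine ⟨Vᴴ * T * U, (hV.conjTranspose.mul hT).mul hU, ?_⟩
  unfold rootFidelity
  rw [← h3]
  have hXh := sqrt_conjTranspose (M * Mᴴ)
  generalize CFC.sqrt (M * Mᴴ) = X at *
  generalize CFC.sqrt (S * Sᴴ) = Y at *
  have h4 : T * (X * Y) = T * U * Mᴴ * S * Vᴴ := by
    rw [← hXh, h1, h2, conjTranspose_mul, conjTranspose_conjTranspose]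
    simp only [Matrix.mul_assoc]
  rw [h4, trace_mul_comm _ Vᴴ]
  simp only [Matrix.mul_assoc]

lemma rootFidelity_nonneg (ρ τ : Matrix n n ℂ) : 0 ≤ rootFidelity ρ τ :=
  trace_re_nonneg (CFC.abs_nonneg _)

/-- A contraction `W` for the compressed factor gives the competitor `W * V` for `τ`. -/
lemma rootFidelity_compress_le {τ T : Matrix n n ℂ} (hτ : 0 ≤ τ) (hT : 0 ≤ T)
    {V : Matrix m n ℂ} (hV : IsContraction V) :
    rootFidelity (CFC.sqrt τ * Vᴴ * (CFC.sqrt τ * Vᴴ)ᴴ) T ≤ rootFidelity τ T := by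
  obtain ⟨W, hW, h⟩ := exists_trace_mul_eq_rootFidelity (CFC.sqrt τ * Vᴴ) (CFC.sqrt T)
  rw [sqrt_mul_conjTranspose hT] at h
  have h2 := trace_mul_re_le_rootFidelity (hW.mul hV) (CFC.sqrt τ) (CFC.sqrt T)
  rw [sqrt_mul_conjTranspose hT, sqrt_mul_conjTranspose hτ] at h2
  rw [← h]
  refine le_trans (le_of_eq ?_) h2
  simp only [conjTranspose_mul, conjTranspose_conjTranspose, Matrix.mul_assoc]

/-- A form of Uhlmann's theorem in which the purifying system has a prescribed dimension. -/
lemma exists_compress_rootFidelity {τ : Matrix n n ℂ} (hτ : 0 ≤ τ) (S : Matrix n m ℂ) :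
    ∃ V : Matrix m n ℂ, IsContraction V ∧
      (CFC.sqrt τ * Vᴴ) * (CFC.sqrt τ * Vᴴ)ᴴ ≤ τ ∧
      ((CFC.sqrt τ * Vᴴ)ᴴ * S).trace.re = rootFidelity τ (S * Sᴴ) := by
  obtain ⟨W, hW, h⟩ := exists_trace_mul_eq_rootFidelity (CFC.sqrt τ) S
  rw [sqrt_mul_conjTranspose hτ] at h
  refine ⟨W, hW, ?_, ?_⟩
  · have h1 := mul_mul_conjTranspose_mono hW (CFC.sqrt τ)
    rw [Matrix.mul_one, sqrt_mul_conjTranspose hτ] at h1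
    simpa only [conjTranspose_mul, conjTranspose_conjTranspose, Matrix.mul_assoc] using h1
  · rw [← h, conjTranspose_mul, conjTranspose_conjTranspose]

end Fidelity

/-! ### Closedness and compactness in the positive cone, and the trace pairing -/

section Cone

variable {m n : Type*} [Fintype m] [Fintype n]

lemma trace_mul_vecMulVec_star (A : Matrix n n ℂ) (x : n → ℂ) :
    (A * vecMulVec x (star x)).trace = star x ⬝ᵥ A *ᵥ x := by
  rw [mul_vecMulVec, trace_vecMulVec, dotProduct_comm]

lemma nonneg_of_re_dotProduct_nonneg {A : Matrix n n ℂ} (hA : A.IsHermitian)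
    (h : ∀ x, 0 ≤ (star x ⬝ᵥ A *ᵥ x).re) : 0 ≤ A := by
  refine (PosSemidef.of_dotProduct_mulVec_nonneg hA fun x => ?_).nonneg
  rw [Complex.le_def]
  exact ⟨h x, (hA.im_star_dotProduct_mulVec_self x).symm⟩

lemma isClosed_nonneg : IsClosed {A : Matrix n n ℂ | 0 ≤ A} := by
  have : {A : Matrix n n ℂ | 0 ≤ A}
      = {A | Aᴴ = A} ∩ ⋂ x : n → ℂ, {A | 0 ≤ (star x ⬝ᵥ A *ᵥ x).re} := by
    ext A
    simp only [Set.mem_ofPred_eq, Set.mem_inter_iff, Set.mem_iInter]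
    exact ⟨fun h => ⟨h.posSemidef.isHermitian, fun x => h.posSemidef.re_dotProduct_nonneg x⟩,
      fun h => nonneg_of_re_dotProduct_nonneg h.1 h.2⟩
  rw [this]
  refine IsClosed.inter (isClosed_eq (by fun_prop) continuous_id)
    (isClosed_iInter fun x => isClosed_le continuous_const ?_)
  exact Complex.continuous_re.comp
    (Continuous.dotProduct continuous_const
      (Continuous.matrix_mulVec continuous_id continuous_const))

lemma trace_conjTranspose_mul_self_re (R : Matrix m n ℂ) :
    (Rᴴ * R).trace.re = ∑ j, ∑ i, ‖R i j‖ ^ 2 := by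
  simp only [trace, diag_apply, mul_apply, conjTranspose_apply, Complex.re_sum]
  refine Finset.sum_congr rfl fun j _ => Finset.sum_congr rfl fun i _ => ?_
  rw [Complex.star_def, ← Complex.normSq_eq_conj_mul_self, Complex.ofReal_re,
    Complex.normSq_eq_norm_sq]

lemma trace_mul_conjTranspose_self_re (R : Matrix m n ℂ) :
    (R * Rᴴ).trace.re = ∑ i, ∑ j, ‖R i j‖ ^ 2 := by
  rw [trace_mul_comm, trace_conjTranspose_mul_self_re, Finset.sum_comm]

lemma isCompact_trace_conjTranspose_mul_self_le (q : ℝ) :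
    IsCompact {R : Matrix m n ℂ | (Rᴴ * R).trace.re ≤ q} := by
  have hc : IsCompact (Set.pi Set.univ fun _ : m => Set.pi Set.univ fun _ : n =>
      Metric.closedBall (0 : ℂ) (√q)) :=
    isCompact_univ_pi fun _ => isCompact_univ_pi fun _ => isCompact_closedBall _ _
  refine IsCompact.of_isClosed_subset hc ?_ ?_
  · exact isClosed_le (Complex.continuous_re.comp (by fun_prop)) continuous_const
  · intro R hR i _ j _
    rw [mem_closedBall_zero_iff]
    refine Real.le_sqrt_of_sq_le (le_trans ?_ hR)
    rw [trace_conjTranspose_mul_self_re]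
    refine le_trans ?_ (Finset.single_le_sum (f := fun j => ∑ i, ‖R i j‖ ^ 2)
      (fun j _ => by positivity) (Finset.mem_univ j))
    exact Finset.single_le_sum (f := fun i => ‖R i j‖ ^ 2)
      (fun j _ => by positivity) (Finset.mem_univ i)

lemma isCompact_nonneg_trace_le (q : ℝ) :
    IsCompact {A : Matrix n n ℂ | 0 ≤ A ∧ A.trace.re ≤ q} := by
  convert (isCompact_trace_conjTranspose_mul_self_le (m := n) (n := n) q).image
    (f := fun R => Rᴴ * R) (by fun_prop) using 1
  ext A
  constructor
  · rintro ⟨h0, h1⟩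
    classical
    obtain ⟨R, rfl⟩ := CStarAlgebra.nonneg_iff_eq_star_mul_self.mp h0
    exact ⟨R, h1, rfl⟩
  · rintro ⟨R, h, rfl⟩
    exact ⟨(posSemidef_conjTranspose_mul_self R).nonneg, h⟩

lemma trace_mul_re_sq_le (X : Matrix m n ℂ) (Y : Matrix n m ℂ) :
    (X * Y).trace.re ^ 2 ≤ (X * Xᴴ).trace.re * (Y * Yᴴ).trace.re := by
  have h1 : |(X * Y).trace.re| ≤ ∑ p : m × n, ‖X p.1 p.2‖ * ‖Y p.2 p.1‖ := by
    refine (Complex.abs_re_le_norm _).trans ?_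
    rw [Fintype.sum_prod_type]
    simp only [trace, diag_apply, mul_apply]
    refine (norm_sum_le _ _).trans (Finset.sum_le_sum fun i _ => (norm_sum_le _ _).trans ?_)
    simp
  have h2 := Finset.sum_mul_sq_le_sq_mul_sq Finset.univ
    (fun p : m × n => ‖X p.1 p.2‖) (fun p : m × n => ‖Y p.2 p.1‖)
  rw [trace_mul_conjTranspose_self_re, trace_mul_conjTranspose_self_re,
    Finset.sum_comm (s := (Finset.univ : Finset n)),
    ← sq_abs]
  simp only [Fintype.sum_prod_type] at h1 h2
  exact (pow_le_pow_left₀ (abs_nonneg _) h1 2).trans h2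

/-- Linear functionals on matrices are given by the trace pairing. -/
lemma exists_trace_mul_eq [DecidableEq n] (f : Matrix n n ℂ →ₗ[ℂ] ℂ) :
    ∃ Z : Matrix n n ℂ, ∀ Y, f Y = (Z * Y).trace := by
  refine ⟨Matrix.of fun j i => f (single i j 1), fun Y => ?_⟩
  conv_lhs => rw [matrix_eq_sum_single Y]
  simp only [map_sum, trace, diag_apply, mul_apply, of_apply]
  rw [Finset.sum_comm]
  refine Finset.sum_congr rfl fun j _ => Finset.sum_congr rfl fun i _ => ?_
  rw [show single i j (Y i j) = Y i j • single i j (1 : ℂ) by simp, map_smul, smul_eq_mul, mul_comm]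

end Cone

/-! ### Partial trace and the separating functional -/

section PartialTrace

variable {A C : Type*} [Fintype A]

/-- The partial trace over the first factor. -/
def partialTraceLeft (Z : Matrix (A × C) (A × C) ℂ) : Matrix C C ℂ :=
  Matrix.of fun c c' => ∑ a, Z (a, c) (a, c')

lemma partialTraceLeft_isHermitian {Z : Matrix (A × C) (A × C) ℂ} (hZ : Z.IsHermitian) :
    (partialTraceLeft Z).IsHermitian := by
  ext c c'
  simp only [partialTraceLeft, conjTranspose_apply, of_apply, star_sum]
  exact Finset.sum_congr rfl fun a _ => hZ.apply _ _

variable [Fintype C] [DecidableEq A]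

lemma trace_one_kronecker_mul (ω : Matrix C C ℂ) (Z : Matrix (A × C) (A × C) ℂ) :
    (((1 : Matrix A A ℂ) ⊗ₖ ω) * Z).trace = (ω * partialTraceLeft Z).trace := by
  simp only [trace, diag_apply, mul_apply, partialTraceLeft, of_apply, kroneckerMap_apply,
    Fintype.sum_prod_type, one_apply, ite_mul, one_mul, zero_mul, Finset.sum_ite_irrel,
    Finset.sum_const_zero, Finset.sum_ite_eq, Finset.mem_univ, if_true, Finset.mul_sum]
  rw [Finset.sum_comm]
  exact Finset.sum_congr rfl fun c _ => Finset.sum_comm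

open scoped Pointwise in
/-- The Lagrange dual certificate for the infeasibility of `τ ≤ 1 ⊗ ω` with `tr ω ≤ q`. -/
lemma exists_dual_certificate [DecidableEq C] {τ : Matrix (A × C) (A × C) ℂ} (hτ : τ.IsHermitian)
    {q : ℝ} (hq : 0 < q)
    (h : ¬ ∃ ω : Matrix C C ℂ, 0 ≤ ω ∧ ω.trace.re ≤ q ∧ τ ≤ (1 : Matrix A A ℂ) ⊗ₖ ω) :
    ∃ Z : Matrix (A × C) (A × C) ℂ, 0 ≤ Z ∧ ∃ μ : ℝ, 0 < μ ∧
      partialTraceLeft Z ≤ (μ : ℂ) • 1 ∧ q * μ < (Z * τ).trace.re := by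
  -- `D₁ + D₂`, compact plus closed, is the closed convex set of all operators below some `1 ⊗ ω`
  -- with `ω ∈ Ω`; `τ` lies outside it.
  set Ω : Set (Matrix C C ℂ) := {ω | 0 ≤ ω ∧ ω.trace.re ≤ q}
  set D₁ : Set (Matrix (A × C) (A × C) ℂ) := (fun ω => (1 : Matrix A A ℂ) ⊗ₖ ω) '' Ω
  set D₂ : Set (Matrix (A × C) (A × C) ℂ) := {Y | 0 ≤ -Y}
  have hcomp : IsCompact D₁ := by
    refine (isCompact_nonneg_trace_le q).image ?_
    refine continuous_matrix fun i j => ?_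
    simp only [kroneckerMap_apply]
    fun_prop
  have hclosed : IsClosed D₂ := isClosed_nonneg.preimage continuous_neg
  have hΩconv : Convex ℝ Ω := by
    rintro x ⟨hx0, hx1⟩ y ⟨hy0, hy1⟩ a b ha hb hab
    refine ⟨add_nonneg (smul_nonneg ha hx0) (smul_nonneg hb hy0), ?_⟩
    simp only [trace_add, trace_smul, Complex.add_re, Complex.smul_re, smul_eq_mul]
    nlinarith
  have hD₁conv : Convex ℝ D₁ := by
    rintro _ ⟨x, hx, rfl⟩ _ ⟨y, hy, rfl⟩ a b ha hb hab
    refine ⟨_, hΩconv hx hy ha hb hab, ?_⟩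
    simp only [kronecker_add, kronecker_smul]
  have hD₂conv : Convex ℝ D₂ := by
    intro x hx y hy a b ha hb hab
    have hx' : 0 ≤ -x := hx
    have hy' : 0 ≤ -y := hy
    have := add_nonneg (smul_nonneg ha hx') (smul_nonneg hb hy')
    simp only [smul_neg] at this
    show 0 ≤ -(a • x + b • y)
    rwa [neg_add]
  have hmem : τ ∉ D₁ + D₂ := by
    rintro ⟨_, ⟨ω, hω, rfl⟩, Y, hY, rfl⟩
    refine h ⟨ω, hω.1, hω.2, ?_⟩
    have hY' : 0 ≤ -Y := hY
    rw [← sub_nonneg]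
    simpa using hY'
  have : LocallyConvexSpace ℝ (Matrix (A × C) (A × C) ℂ) :=
    inferInstanceAs (LocallyConvexSpace ℝ ((A × C) → (A × C) → ℂ))
  obtain ⟨f, u, hf, hfτ⟩ := RCLike.geometric_hahn_banach_closed_point (𝕜 := ℂ)
    (hD₁conv.add hD₂conv) (hclosed.add_left_of_isCompact hcomp) hmem
  obtain ⟨Z₀, hZ₀⟩ := exists_trace_mul_eq f.toLinearMap
  -- On Hermitian arguments the real part of the functional depends only on the Hermitian part of
  -- `Z₀`.
  set Z : Matrix (A × C) (A × C) ℂ := (1 / 2 : ℝ) • (Z₀ + Z₀ᴴ) with hZdef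
  have hZh : Z.IsHermitian := by
    simp only [hZdef, Matrix.IsHermitian, conjTranspose_smul, conjTranspose_add,
      conjTranspose_conjTranspose, star_trivial]
    rw [add_comm]
  have hZf : ∀ Y : Matrix (A × C) (A × C) ℂ, Y.IsHermitian →
      RCLike.re (f Y) = (Z * Y).trace.re := by
    intro Y hY
    have h1 : (Z₀ᴴ * Y).trace.re = (Z₀ * Y).trace.re := by
      rw [trace_mul_comm Z₀ Y, ← Complex.conj_re (trace (Y * Z₀))]
      change _ = (star (trace (Y * Z₀))).re
      rw [← trace_conjTranspose, conjTranspose_mul, hY.eq]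
    have h2 : f Y = (Z₀ * Y).trace := hZ₀ Y
    rw [h2, hZdef, smul_mul_assoc, Matrix.add_mul, trace_smul, trace_add, Complex.smul_re,
      Complex.add_re, h1]
    simp
    ring
  rw [hZf τ hτ] at hfτ
  have hD : ∀ ω ∈ Ω, ∀ P : Matrix (A × C) (A × C) ℂ, 0 ≤ P →
      (Z * ((1 : Matrix A A ℂ) ⊗ₖ ω)).trace.re - (Z * P).trace.re < u := by
    intro ω hω P hP
    have h1 := hf ((1 : Matrix A A ℂ) ⊗ₖ ω + -P)
      (Set.add_mem_add ⟨ω, hω, rfl⟩ (by simpa [D₂] using hP))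
    have hk : ((1 : Matrix A A ℂ) ⊗ₖ ω).IsHermitian :=
      (PosSemidef.one.kronecker hω.1.posSemidef).isHermitian
    rw [hZf _ (hk.add hP.posSemidef.isHermitian.neg), Matrix.mul_add, trace_add, Matrix.mul_neg,
      trace_neg, Complex.add_re, Complex.neg_re] at h1
    linarith
  have h0Ω : (0 : Matrix C C ℂ) ∈ Ω := ⟨le_rfl, by simpa using hq.le⟩
  have hu : 0 < u := by simpa using hD 0 h0Ω 0 le_rfl
  have hZ : 0 ≤ Z := by
    refine nonneg_of_re_dotProduct_nonneg hZh fun x => ?_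
    rw [← trace_mul_vecMulVec_star]
    by_contra hneg
    push Not at hneg
    set r := (Z * vecMulVec x (star x)).trace.re with hr
    -- A negative value `r` could be scaled along the cone until the functional reaches the bound
    -- `u`.
    have hpos : (0 : ℝ) ≤ u / (-r) := div_nonneg hu.le (by linarith)
    have h1 := hD 0 h0Ω ((u / (-r)) • vecMulVec x (star x))
      (smul_nonneg hpos (posSemidef_vecMulVec_self_star x).nonneg)
    rw [mul_smul_comm, trace_smul, Complex.smul_re, ← hr] at h1
    have h2 : u / (-r) * r = -u := by
      rw [div_neg, neg_mul, div_mul_cancel₀ _ hneg.ne]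
    simp [h2] at h1
  refine ⟨Z, hZ, u / q, div_pos hu hq, ?_, ?_⟩
  · rw [← sub_nonneg]
    refine nonneg_of_re_dotProduct_nonneg ?_ fun x => ?_
    · refine IsHermitian.sub ?_ (partialTraceLeft_isHermitian hZh)
      simp [Matrix.IsHermitian, conjTranspose_smul]
    · by_cases hx : x = 0
      · simp [hx]
      set t : ℝ := (star x ⬝ᵥ x).re with ht
      have htpos : 0 < t := (Complex.pos_iff.mp (dotProduct_star_self_pos_iff.mpr hx)).1
      have htr : (vecMulVec x (star x)).trace.re = t := by
        rw [trace_vecMulVec, dotProduct_comm]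
      -- The scaling `q / t` gives this test operator trace exactly `q`, the extreme case in `Ω`;
      -- hence `μ = u / q`.
      have h1 := hD ((q / t) • vecMulVec x (star x))
        ⟨smul_nonneg (by positivity) (posSemidef_vecMulVec_self_star x).nonneg, by
          rw [trace_smul, Complex.smul_re, htr, smul_eq_mul, div_mul_cancel₀ _ htpos.ne']⟩ 0 le_rfl
      rw [trace_mul_comm, trace_one_kronecker_mul, smul_mul_assoc, trace_smul, Complex.smul_re,
        trace_mul_comm, trace_mul_vecMulVec_star] at h1
      simp only [sub_mulVec, dotProduct_sub, smul_mulVec, one_mulVec, dotProduct_smul,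
        Complex.sub_re, smul_eq_mul, Complex.re_ofReal_mul, ← ht]
      simp only [smul_eq_mul, mul_zero, trace_zero, Complex.zero_re, sub_zero] at h1
      rw [div_mul_eq_mul_div, div_lt_iff₀ htpos] at h1
      rw [sub_nonneg, div_mul_eq_mul_div, le_div_iff₀ hq]
      linarith
  · rwa [mul_div_cancel₀ _ hq.ne']

end PartialTrace

/-! ### Unsmoothed duality at the level of fidelities and traces -/

section Duality

variable {A B C R : Type*}

/-- The operator `C → A ⊗ B` associated with a vector of `A ⊗ B ⊗ C`. -/
def operatorAB (ψ : A × B × C → ℂ) : Matrix (A × B) C ℂ :=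
  Matrix.of fun i c => ψ (i.1, i.2, c)

/-- The operator `B → A ⊗ C` associated with a vector of `A ⊗ B ⊗ C`. -/
def operatorAC (ψ : A × B × C → ℂ) : Matrix (A × C) B ℂ :=
  Matrix.of fun i b => ψ (i.1, b, i.2)

/-- Regrouping of an operator `R → A ⊗ C` as an operator `C → A ⊗ R`. -/
def regroup (K : Matrix (A × C) R ℂ) : Matrix (A × R) C ℂ :=
  Matrix.of fun x c => K (x.1, c) x.2

lemma marginalAB_vecMulVec [Fintype C] (ψ : A × B × C → ℂ) :
    marginalAB (vecMulVec ψ (star ψ)) = operatorAB ψ * (operatorAB ψ)ᴴ := by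
  ext i j
  simp [marginalAB, operatorAB, mul_apply, vecMulVec_apply]

lemma marginalAC_vecMulVec [Fintype B] (ψ : A × B × C → ℂ) :
    marginalAC (vecMulVec ψ (star ψ)) = operatorAC ψ * (operatorAC ψ)ᴴ := by
  ext i j
  simp [marginalAC, operatorAC, mul_apply, vecMulVec_apply]

variable [Fintype A] [Fintype R]

/-- This turns contractivity of `regroup K` into the bound `partialTraceLeft (K * Kᴴ) ≤ 1`. -/
lemma regroup_conjTranspose_mul_self (K : Matrix (A × C) R ℂ) :
    (regroup K)ᴴ * regroup K = (partialTraceLeft (K * Kᴴ))ᵀ := by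
  ext c c'
  simp [regroup, partialTraceLeft, mul_apply, Fintype.sum_prod_type, mul_comm]

variable [Fintype B] [Fintype C]

/-- Both sides are the sum of `K (a, c) r * star (ψ (a, b, c)) * s b r` over all indices; the
identity moves the problem from `AB` to `AC`. -/
lemma trace_regroup_mul [DecidableEq A] (ψ : A × B × C → ℂ) (K : Matrix (A × C) R ℂ)
    (s : Matrix B R ℂ) :
    (regroup K * (operatorAB ψ)ᴴ * ((1 : Matrix A A ℂ) ⊗ₖ s)).trace
      = ((operatorAC ψ)ᴴ * K * sᵀ).trace := by
  simp only [trace, diag_apply, mul_apply, regroup, operatorAB, operatorAC, of_apply,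
    conjTranspose_apply, transpose_apply, kroneckerMap_apply, Fintype.sum_prod_type, one_apply,
    ite_mul, one_mul, zero_mul, mul_ite, mul_zero, Finset.sum_ite_irrel, Finset.sum_const_zero,
    Finset.sum_ite_eq', Finset.mem_univ, if_true, Finset.sum_mul]
  rw [Finset.sum_comm]
  conv_rhs => rw [Finset.sum_comm]
  refine Finset.sum_congr rfl fun r _ => ?_
  rw [Finset.sum_comm]
  refine Finset.sum_congr rfl fun b _ => Finset.sum_congr rfl fun a _ =>
    Finset.sum_congr rfl fun c _ => ?_
  ring

variable [DecidableEq A] [DecidableEq B] [DecidableEq C]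

/-- Weak duality between the conditional max- and min-entropies. -/
lemma fidelity_le_trace (ψ : A × B × C → ℂ) {ω : Matrix C C ℂ} (hω : 0 ≤ ω)
    (h : operatorAC ψ * (operatorAC ψ)ᴴ ≤ (1 : Matrix A A ℂ) ⊗ₖ ω)
    {σ : Matrix B B ℂ} (hσ : σ ∈ SubNormalized) :
    fidelity (operatorAB ψ * (operatorAB ψ)ᴴ) ((1 : Matrix A A ℂ) ⊗ₖ σ) ≤ ω.trace.re := by
  have hσ0 : 0 ≤ σ := hσ.1.nonneg
  set s := CFC.sqrt σ with hs
  have hS : ((1 : Matrix A A ℂ) ⊗ₖ s) * ((1 : Matrix A A ℂ) ⊗ₖ s)ᴴ = (1 : Matrix A A ℂ) ⊗ₖ σ := by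
    rw [conjTranspose_kronecker, conjTranspose_one, ← mul_kronecker_mul, Matrix.one_mul,
      sqrt_mul_conjTranspose hσ0]
  obtain ⟨W, hW, h1⟩ := exists_trace_mul_eq_rootFidelity (operatorAB ψ) ((1 : Matrix A A ℂ) ⊗ₖ s)
  rw [hS] at h1
  set K : Matrix (A × C) B ℂ := Matrix.of fun i r => W (i.1, r) i.2 with hK
  have hWK : W = regroup K := rfl
  rw [hWK, trace_regroup_mul] at h1
  unfold fidelity
  rw [← h1]
  -- Cauchy–Schwarz splits off `sᵀ`, whose squared Hilbert–Schmidt norm is `tr σ ≤ 1`.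
  refine (trace_mul_re_sq_le _ _).trans ?_
  have h2 : (sᵀ * sᵀᴴ).trace.re ≤ 1 := by
    have : sᵀ * sᵀᴴ = (sᴴ * s)ᵀ := by
      rw [transpose_mul]
      rfl
    rw [this, trace_transpose, trace_mul_comm, sqrt_mul_conjTranspose hσ0]
    exact hσ.2
  have h3 : ((operatorAC ψ)ᴴ * K * ((operatorAC ψ)ᴴ * K)ᴴ).trace.re ≤ ω.trace.re := by
    have e : ((operatorAC ψ)ᴴ * K * ((operatorAC ψ)ᴴ * K)ᴴ).trace
        = (operatorAC ψ * (operatorAC ψ)ᴴ * (K * Kᴴ)).trace := by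
      rw [conjTranspose_mul, conjTranspose_conjTranspose, ← Matrix.mul_assoc, trace_mul_comm]
      simp only [Matrix.mul_assoc]
    rw [e]
    refine (trace_mul_re_mono h (posSemidef_self_mul_conjTranspose K).nonneg).trans ?_
    rw [trace_one_kronecker_mul, trace_mul_comm]
    have h4 : partialTraceLeft (K * Kᴴ) ≤ 1 := by
      rw [IsContraction, hWK, regroup_conjTranspose_mul_self, Matrix.le_iff] at hW
      rw [Matrix.le_iff]
      have := hW.transpose
      rwa [transpose_sub, transpose_transpose, transpose_one] at this
    simpa using trace_mul_re_mono h4 hω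
  have h5 : 0 ≤ ((operatorAC ψ)ᴴ * K * ((operatorAC ψ)ᴴ * K)ᴴ).trace.re :=
    trace_re_nonneg (posSemidef_self_mul_conjTranspose _).nonneg
  calc _ ≤ ((operatorAC ψ)ᴴ * K * ((operatorAC ψ)ᴴ * K)ᴴ).trace.re * 1 := by gcongr
    _ ≤ _ := by rw [mul_one]; exact h3

/-- Strong duality between the conditional max- and min-entropies. -/
lemma exists_lt_fidelity (ψ : A × B × C → ℂ) {q : ℝ} (hq : 0 < q)
    (h : ¬ ∃ ω : Matrix C C ℂ, 0 ≤ ω ∧ ω.trace.re ≤ q ∧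
      operatorAC ψ * (operatorAC ψ)ᴴ ≤ (1 : Matrix A A ℂ) ⊗ₖ ω) :
    ∃ σ : Matrix B B ℂ, σ ∈ SubNormalized ∧
      q < fidelity (operatorAB ψ * (operatorAB ψ)ᴴ) ((1 : Matrix A A ℂ) ⊗ₖ σ) := by
  obtain ⟨Z, hZ, μ, hμ, hZμ, hlt⟩ := exists_dual_certificate
    (isHermitian_mul_conjTranspose_self (operatorAC ψ)) hq h
  set K := CFC.sqrt Z with hKdef
  have hK : K * Kᴴ = Z := sqrt_mul_conjTranspose hZ
  set v := (operatorAC ψ)ᴴ * K with hv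
  set t := (v * vᴴ).trace.re with ht
  have htZ : (Z * (operatorAC ψ * (operatorAC ψ)ᴴ)).trace.re = t := by
    rw [ht, hv, conjTranspose_mul, conjTranspose_conjTranspose, ← hK, ← Matrix.mul_assoc,
      trace_mul_comm]
    simp only [Matrix.mul_assoc]
  rw [htZ] at hlt
  have htpos : 0 < t := lt_trans (by positivity) hlt
  have htc : (v * vᴴ).trace = (t : ℂ) := by
    have h0 := (Complex.le_def.mp (posSemidef_self_mul_conjTranspose v).trace_nonneg).2
    exact Complex.ext rfl h0.symm
  -- This is the equality case of Cauchy–Schwarz: `sᵀ` is proportional to `vᴴ`, normalized so that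
  -- `s * sᴴ` has trace one.
  set s : Matrix B (A × C) ℂ := ((√t)⁻¹ : ℂ) • vᴴᵀ with hs
  have hst : s * sᴴ = ((t⁻¹ : ℝ) : ℂ) • (v * vᴴ)ᵀ := by
    have e : (v * vᴴ)ᵀ = vᴴᵀ * vᵀ := transpose_mul _ _
    have e' : (vᴴᵀ)ᴴ = vᵀ := by
      ext i j
      simp
    have e2 : ((√t)⁻¹ : ℂ) * star ((√t)⁻¹ : ℂ) = ((t⁻¹ : ℝ) : ℂ) := by
      rw [← Complex.ofReal_inv, Complex.star_def, Complex.conj_ofReal, ← Complex.ofReal_mul,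
        ← mul_inv, Real.mul_self_sqrt htpos.le]
    rw [hs, conjTranspose_smul, Matrix.smul_mul, Matrix.mul_smul, smul_smul, e', e, e2]
  refine ⟨s * sᴴ, ⟨posSemidef_self_mul_conjTranspose s, ?_⟩, ?_⟩
  · rw [hst, trace_smul, trace_transpose, htc, smul_eq_mul, ← Complex.ofReal_mul,
      Complex.ofReal_re, inv_mul_cancel₀ htpos.ne']
  -- The factor `1 / √μ` makes `W` a contraction, since the partial trace of `Z` is at most `μ`.
  set W : Matrix (A × (A × C)) C ℂ := regroup (((√μ)⁻¹ : ℂ) • K) with hWdef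
  have hW : IsContraction W := by
    have e2 : ((√μ)⁻¹ : ℂ) * star ((√μ)⁻¹ : ℂ) = ((μ⁻¹ : ℝ) : ℂ) := by
      rw [← Complex.ofReal_inv, Complex.star_def, Complex.conj_ofReal, ← Complex.ofReal_mul,
        ← mul_inv, Real.mul_self_sqrt hμ.le]
    have e3 : partialTraceLeft (((μ⁻¹ : ℝ) : ℂ) • Z) = ((μ⁻¹ : ℝ) : ℂ) • partialTraceLeft Z := by
      ext c c'
      simp [partialTraceLeft, Finset.mul_sum]
    unfold IsContraction
    rw [regroup_conjTranspose_mul_self, conjTranspose_smul, Matrix.smul_mul, Matrix.mul_smul,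
      smul_smul, hK, e2, e3, Matrix.le_iff, ← transpose_one, ← transpose_sub]
    refine PosSemidef.transpose ?_
    have h1 := (Matrix.le_iff.mp hZμ).smul (a := ((μ⁻¹ : ℝ) : ℂ))
      (Complex.zero_le_real.mpr (inv_nonneg.mpr hμ.le))
    rwa [smul_sub, smul_smul, ← Complex.ofReal_mul, inv_mul_cancel₀ hμ.ne', Complex.ofReal_one,
      one_smul] at h1
  have h1 := trace_mul_re_le_rootFidelity hW (operatorAB ψ) ((1 : Matrix A A ℂ) ⊗ₖ s)
  have hS : ((1 : Matrix A A ℂ) ⊗ₖ s) * ((1 : Matrix A A ℂ) ⊗ₖ s)ᴴ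
      = (1 : Matrix A A ℂ) ⊗ₖ (s * sᴴ) := by
    rw [conjTranspose_kronecker, conjTranspose_one, ← mul_kronecker_mul, Matrix.one_mul]
  have hval : (W * (operatorAB ψ)ᴴ * ((1 : Matrix A A ℂ) ⊗ₖ s)).trace.re = √t / √μ := by
    rw [hWdef, trace_regroup_mul, Matrix.mul_smul, hs, transpose_smul, transpose_transpose,
      Matrix.mul_smul, Matrix.smul_mul, ← hv, trace_smul, trace_smul, htc, smul_eq_mul, smul_eq_mul,
      ← Complex.ofReal_inv, ← Complex.ofReal_inv, ← Complex.ofReal_mul, ← Complex.ofReal_mul,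
      Complex.ofReal_re]
    have : √t ≠ 0 := (Real.sqrt_pos.mpr htpos).ne'
    nth_rewrite 2 [← Real.mul_self_sqrt htpos.le]
    field_simp
  rw [hval, hS] at h1
  unfold fidelity
  calc q < t / μ := by rwa [lt_div_iff₀ hμ]
    _ = (√t / √μ) ^ 2 := by rw [div_pow, Real.sq_sqrt htpos.le, Real.sq_sqrt hμ.le]
    _ ≤ _ := pow_le_pow_left₀ (by positivity) h1 2

end Duality

/-! ### From fidelities and traces to extended-real entropies -/

section Entropy

lemma elog_le_iff {b : ℝ} (hb : 1 < b) {x : ℝ} (hx : 0 ≤ x) (l : ℝ) :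
    elog b x ≤ (l : EReal) ↔ x ≤ b ^ l := by
  have hb0 : 0 < b := by linarith
  unfold elog
  split_ifs with h
  · simp only [h, bot_le, true_iff]
    positivity
  · have hx' : 0 < x := lt_of_le_of_ne hx (Ne.symm h)
    rw [EReal.coe_le_coe_iff, Real.logb_le_iff_le_rpow hb hx']

variable {A B C : Type*} [Fintype A] [Fintype B] [Fintype C]
  [DecidableEq A] [DecidableEq B] [DecidableEq C]

lemma Hmax_le_iff {b : ℝ} (hb : 1 < b) (ρ : Matrix (A × B) (A × B) ℂ) (l : ℝ) :
    Hmax b ρ ≤ (l : EReal) ↔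
      ∀ σ ∈ (SubNormalized : Set (Matrix B B ℂ)),
        fidelity ρ ((1 : Matrix A A ℂ) ⊗ₖ σ) ≤ b ^ l := by
  unfold Hmax
  rw [iSup₂_le_iff]
  exact forall₂_congr fun σ _ => elog_le_iff hb (sq_nonneg _) l

/-- The scale `b ^ (-l)` is absorbed into an unnormalized `ω`. With `Hmin_le`, this reduces `Hmin`
to minimizing `tr ω` subject to `ρ ≤ 1 ⊗ ω`. -/
lemma le_Hmin {b : ℝ} (hb : 1 < b) {ρ : Matrix (A × B) (A × B) ℂ} {ω : Matrix B B ℂ} (hω : 0 ≤ ω)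
    (h : ρ ≤ (1 : Matrix A A ℂ) ⊗ₖ ω) {l : ℝ} (hl : ω.trace.re ≤ b ^ (-l)) :
    (l : EReal) ≤ Hmin b ρ := by
  have hpos : 0 < b ^ (-l) := Real.rpow_pos_of_pos (by linarith) _
  unfold Hmin
  refine le_iSup₂_of_le ((b ^ (-l))⁻¹ • ω)
    ⟨(smul_nonneg (inv_nonneg.mpr hpos.le) hω).posSemidef, ?_⟩ ?_
  · rw [trace_smul, Complex.smul_re, smul_eq_mul, inv_mul_le_iff₀ hpos, mul_one]
    exact hl
  · refine le_iSup₂_of_le l ?_ le_rfl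
    show ρ ≤ _
    rwa [kronecker_smul, smul_smul, mul_inv_cancel₀ hpos.ne', one_smul]

lemma Hmin_le {b : ℝ} (hb : 1 < b) {ρ : Matrix (A × B) (A × B) ℂ} {x : EReal}
    (h : ∀ (ω : Matrix B B ℂ) (l : ℝ), 0 ≤ ω → ω.trace.re ≤ b ^ (-l) →
      ρ ≤ (1 : Matrix A A ℂ) ⊗ₖ ω → (l : EReal) ≤ x) : Hmin b ρ ≤ x := by
  have hb0 : 0 < b := by linarith
  refine iSup₂_le fun σ hσ => iSup₂_le fun l hl => ?_
  have hpos : 0 < b ^ (-l) := Real.rpow_pos_of_pos hb0 _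
  have hl' : ρ ≤ (b ^ (-l)) • ((1 : Matrix A A ℂ) ⊗ₖ σ) := hl
  refine h ((b ^ (-l)) • σ) l (smul_nonneg hpos.le hσ.1.nonneg) ?_ ?_
  · rw [trace_smul, Complex.smul_re, smul_eq_mul]
    exact mul_le_of_le_one_right hpos.le hσ.2
  · rwa [kronecker_smul]

/-- Duality of the conditional min- and max-entropies of a pure state. -/
theorem Hmax_operatorAB_eq_neg_Hmin_operatorAC {b : ℝ} (hb : 1 < b) (ψ : A × B × C → ℂ) :
    Hmax b (operatorAB ψ * (operatorAB ψ)ᴴ) = -Hmin b (operatorAC ψ * (operatorAC ψ)ᴴ) := by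
  have hb0 : 0 < b := by linarith
  refine le_antisymm ?_ ?_
  · rw [EReal.le_neg]
    refine Hmin_le hb fun ω l hω hl h => ?_
    rw [EReal.le_neg, ← EReal.coe_neg, Hmax_le_iff hb]
    exact fun σ hσ => (fidelity_le_trace ψ hω h hσ).trans hl
  -- Testing against real `l > Hmax` covers infinite values; strong duality is then used at `q = b ^
  -- l`.
  · rw [← EReal.le_of_forall_lt_iff_le]
    intro l hl
    rw [EReal.neg_le, ← EReal.coe_neg]
    by_contra hcon
    obtain ⟨σ, hσ, hlt⟩ := exists_lt_fidelity ψ (q := b ^ l) (Real.rpow_pos_of_pos hb0 _) (by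
      rintro ⟨ω, hω, hq, h⟩
      exact hcon (le_Hmin hb hω h (by rwa [neg_neg])))
    exact absurd ((Hmax_le_iff hb _ _).mp hl.le σ hσ) (not_le.mpr hlt)

end Entropy

/-! ### Purified-distance balls and purifications -/

section Ball

variable {m n : Type*} [Fintype m] [Fintype n] [DecidableEq m] [DecidableEq n]

lemma mem_ball_iff {ε : ℝ} (hε : 0 ≤ ε) {τ ρ : Matrix n n ℂ} :
    τ ∈ ball ε ρ ↔ τ ∈ SubNormalized ∧
      √(1 - ε ^ 2) ≤ rootFidelity τ ρ + √((1 - τ.trace.re) * (1 - ρ.trace.re)) := by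
  have h0 : 0 ≤ rootFidelity τ ρ + √((1 - τ.trace.re) * (1 - ρ.trace.re)) :=
    add_nonneg (rootFidelity_nonneg τ ρ) (Real.sqrt_nonneg _)
  refine and_congr_right fun _ => ?_
  unfold purifiedDistance genFidelity
  rw [Real.sqrt_le_left hε, Real.sqrt_le_left h0]
  constructor <;> intro h <;> linarith

lemma mem_ball_of_trace_le {ε : ℝ} (hε : 0 ≤ ε) {N S : Matrix n m ℂ}
    (hN : (N * Nᴴ).trace.re ≤ 1)
    (h : √(1 - ε ^ 2) ≤ (Nᴴ * S).trace.re
      + √((1 - (N * Nᴴ).trace.re) * (1 - (S * Sᴴ).trace.re))) :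
    N * Nᴴ ∈ ball ε (S * Sᴴ) := by
  rw [mem_ball_iff hε]
  refine ⟨⟨posSemidef_self_mul_conjTranspose N, hN⟩, h.trans ?_⟩
  have := trace_mul_re_le_rootFidelity (isContraction_one (n := m)) N S
  rw [Matrix.one_mul] at this
  gcongr

/-- The factor `N` attains the root fidelity of `τ` as its overlap with `S`. The purifying space is
fixed, so `N * Nᴴ` need only lie below `τ`; its smaller trace can only enlarge the second term of
the generalized fidelity. -/
lemma exists_trace_le_of_mem_ball {ε : ℝ} (hε : 0 ≤ ε) {τ : Matrix n n ℂ} {S : Matrix n m ℂ}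
    (hS : (S * Sᴴ).trace.re ≤ 1) (hτ : τ ∈ ball ε (S * Sᴴ)) :
    ∃ N : Matrix n m ℂ, N * Nᴴ ≤ τ ∧ (N * Nᴴ).trace.re ≤ 1 ∧
      √(1 - ε ^ 2) ≤ (Nᴴ * S).trace.re
        + √((1 - (N * Nᴴ).trace.re) * (1 - (S * Sᴴ).trace.re)) ∧
      ∀ T : Matrix n n ℂ, 0 ≤ T → rootFidelity (N * Nᴴ) T ≤ rootFidelity τ T := by
  rw [mem_ball_iff hε] at hτ
  obtain ⟨⟨hτ0, hτ1⟩, h⟩ := hτ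
  obtain ⟨V, hV, hle, htr⟩ := exists_compress_rootFidelity hτ0.nonneg S
  have hmono := trace_re_mono hle
  refine ⟨_, hle, hmono.trans hτ1, ?_, fun T hT => rootFidelity_compress_le hτ0.nonneg hT hV⟩
  rw [htr]
  refine h.trans ?_
  have : 0 ≤ 1 - (S * Sᴴ).trace.re := by linarith
  gcongr

end Ball

/-! ### Rank-one operators and an upper bound by a multiple of the identity -/

section RankOne

variable {n : Type*} [Fintype n] [DecidableEq n]

lemma exists_eq_vecMulVec_of_rank_eq_one {ρ : Matrix n n ℂ} (hρ : ρ.PosSemidef)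
    (hr : ρ.rank = 1) : ∃ ψ : n → ℂ, ρ = vecMulVec ψ (star ψ) := by
  have hH := hρ.isHermitian
  rw [hH.rank_eq_card_non_zero_eigs, Fintype.card_eq_one_iff] at hr
  obtain ⟨⟨k, hk⟩, huniq⟩ := hr
  have hz : ∀ j, j ≠ k → hH.eigenvalues j = 0 := by
    intro j hj
    by_contra hne
    exact hj (congrArg Subtype.val (huniq ⟨j, hne⟩))
  -- The only surviving spectral term is `k`; its eigenvector absorbs the square root of the
  -- eigenvalue.
  refine ⟨fun i => (√(hH.eigenvalues k) : ℂ) * (hH.eigenvectorUnitary : Matrix n n ℂ) i k, ?_⟩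
  ext i j
  conv_lhs => rw [hH.spectral_theorem]
  rw [Unitary.conjStarAlgAut_apply, mul_apply, Finset.sum_eq_single k]
  · rw [mul_diagonal, vecMulVec_apply, star_apply, Pi.star_apply, star_mul', Complex.star_def,
      Complex.conj_ofReal, Function.comp_apply]
    have h2 : ((√(hH.eigenvalues k) : ℝ) : ℂ) * ((√(hH.eigenvalues k) : ℝ) : ℂ)
        = (hH.eigenvalues k : ℂ) := by
      rw [← Complex.ofReal_mul, Real.mul_self_sqrt (hρ.eigenvalues_nonneg k)]
    change _ * (hH.eigenvalues k : ℂ) * _ = _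
    rw [← h2]
    ring
  · intro l _ hl
    rw [mul_diagonal, Function.comp_apply, hz l hl]
    simp
  · simp

open scoped Matrix.Norms.L2Operator in
lemma exists_le_smul_one {τ : Matrix n n ℂ} (hτ : τ.IsHermitian) :
    ∃ t : ℝ, 0 ≤ t ∧ τ ≤ t • (1 : Matrix n n ℂ) := by
  refine ⟨‖τ‖, norm_nonneg _, ?_⟩
  have := IsSelfAdjoint.le_algebraMap_norm_self (a := τ) hτ
  rwa [Algebra.algebraMap_eq_smul_one] at this

end RankOne

/-! ### The common ball of vectors -/

section Vectors

variable {A B C : Type*}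

lemma operatorAB_surjective (N : Matrix (A × B) C ℂ) : ∃ φ : A × B × C → ℂ, operatorAB φ = N :=
  ⟨fun x => N (x.1, x.2.1) x.2.2, rfl⟩

lemma operatorAC_surjective (N : Matrix (A × C) B ℂ) : ∃ φ : A × B × C → ℂ, operatorAC φ = N :=
  ⟨fun x => N (x.1, x.2.2) x.2.1, rfl⟩

lemma operatorAC_eq_zero {φ : A × B × C → ℂ} (h : operatorAC φ = 0) : φ = 0 := by
  ext ⟨a, b, c⟩
  exact congrFun (congrFun h (a, c)) b

variable [Fintype A] [Fintype B] [Fintype C]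

/-- The overlap agrees with that in `trace_operatorAC`, which is why a single `vectorBall` serves
both marginals. -/
lemma trace_operatorAB (φ ψ : A × B × C → ℂ) :
    ((operatorAB φ)ᴴ * operatorAB ψ).trace = star φ ⬝ᵥ ψ := by
  simp only [trace, diag_apply, mul_apply, operatorAB, conjTranspose_apply, of_apply, dotProduct,
    Fintype.sum_prod_type, Pi.star_apply]
  rw [Finset.sum_comm]
  exact Finset.sum_congr rfl fun a _ => Finset.sum_comm

lemma trace_operatorAC (φ ψ : A × B × C → ℂ) :
    ((operatorAC φ)ᴴ * operatorAC ψ).trace = star φ ⬝ᵥ ψ := by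
  simp only [trace, diag_apply, mul_apply, operatorAC, conjTranspose_apply, of_apply, dotProduct,
    Fintype.sum_prod_type, Pi.star_apply]
  rw [Finset.sum_comm]

/-- Sub-normalized vectors whose pure state is `ε`-close to that of `ψ`. -/
def vectorBall {X : Type*} [Fintype X] (ε : ℝ) (ψ : X → ℂ) : Set (X → ℂ) :=
  {φ | (star φ ⬝ᵥ φ).re ≤ 1 ∧ √(1 - ε ^ 2) ≤ (star φ ⬝ᵥ ψ).re
    + √((1 - (star φ ⬝ᵥ φ).re) * (1 - (star ψ ⬝ᵥ ψ).re))}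

lemma isCompact_vectorBall {X : Type*} [Fintype X] (ε : ℝ) (ψ : X → ℂ) :
    IsCompact (vectorBall ε ψ) := by
  have hc : IsCompact (Set.pi Set.univ fun _ : X => Metric.closedBall (0 : ℂ) 1) :=
    isCompact_univ_pi fun _ => isCompact_closedBall _ _
  have h1 : Continuous fun φ : X → ℂ => (star φ ⬝ᵥ φ).re :=
    Complex.continuous_re.comp (continuous_star.dotProduct continuous_id)
  have h2 : Continuous fun φ : X → ℂ => (star φ ⬝ᵥ ψ).re :=
    Complex.continuous_re.comp (continuous_star.dotProduct continuous_const)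
  refine hc.of_isClosed_subset ?_ ?_
  · exact (isClosed_le h1 continuous_const).inter (isClosed_le continuous_const
      (h2.add ((continuous_const.sub h1).mul continuous_const).sqrt))
  · intro φ hφ x _
    rw [mem_closedBall_zero_iff]
    have h3 : (star φ ⬝ᵥ φ).re = ∑ x, ‖φ x‖ ^ 2 := by
      simp only [dotProduct, Pi.star_apply, Complex.re_sum]
      refine Finset.sum_congr rfl fun i _ => ?_
      rw [Complex.star_def, ← Complex.normSq_eq_conj_mul_self, Complex.ofReal_re,
        Complex.normSq_eq_norm_sq]
    have h4 : ‖φ x‖ ^ 2 ≤ 1 := by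
      refine le_trans ?_ (h3 ▸ hφ.1)
      exact Finset.single_le_sum (f := fun x => ‖φ x‖ ^ 2) (fun _ _ => by positivity)
        (Finset.mem_univ x)
    exact (sq_le_one_iff₀ (norm_nonneg _)).mp h4

lemma self_mem_vectorBall {X : Type*} [Fintype X] (ε : ℝ) {ψ : X → ℂ}
    (hψ : (star ψ ⬝ᵥ ψ).re ≤ 1) : ψ ∈ vectorBall ε ψ := by
  refine ⟨hψ, ?_⟩
  rw [Real.sqrt_mul_self (by linarith), add_sub_cancel]
  exact Real.sqrt_le_one.mpr (by nlinarith [sq_nonneg ε])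

/-- At the zero vector the condition reads `√(1 - ε²) ≤ √(1 - ‖ψ‖²)`, with the Euclidean norm,
contradicting `ε < ‖ψ‖`. -/
lemma zero_notMem_vectorBall {X : Type*} [Fintype X] {ε : ℝ} (hε : 0 ≤ ε) {ψ : X → ℂ}
    (hψ : (star ψ ⬝ᵥ ψ).re ≤ 1) (h : ε < √((star ψ ⬝ᵥ ψ).re)) : (0 : X → ℂ) ∉ vectorBall ε ψ := by
  rintro ⟨-, h2⟩
  simp only [star_zero, zero_dotProduct, Complex.zero_re, zero_add, sub_zero, one_mul] at h2
  have h3 := (Real.lt_sqrt hε).mp h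
  exact absurd h2 (not_le.mpr (Real.sqrt_lt_sqrt (by linarith) (by linarith)))

variable [DecidableEq A] [DecidableEq C]

/-- The operators `ω` certifying a bound on the smooth min-entropy attain their least trace. -/
lemma exists_minimal_trace (ε : ℝ) {ψ : A × B × C → ℂ} (hψ : (star ψ ⬝ᵥ ψ).re ≤ 1) :
    ∃ φ ∈ vectorBall ε ψ, ∃ ω : Matrix C C ℂ, 0 ≤ ω ∧
      operatorAC φ * (operatorAC φ)ᴴ ≤ (1 : Matrix A A ℂ) ⊗ₖ ω ∧
      ∀ φ' ∈ vectorBall ε ψ, ∀ ω' : Matrix C C ℂ, 0 ≤ ω' →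
        operatorAC φ' * (operatorAC φ')ᴴ ≤ (1 : Matrix A A ℂ) ⊗ₖ ω' →
        ω.trace.re ≤ ω'.trace.re := by
  obtain ⟨t, ht, hle⟩ := exists_le_smul_one (isHermitian_mul_conjTranspose_self (operatorAC ψ))
  -- `q` is the trace of a certificate feasible for `ψ` itself, so restricting to `tr ω ≤ q` keeps
  -- the minimum and makes the search set compact.
  set q : ℝ := (t • (1 : Matrix C C ℂ)).trace.re
  set F : Set ((A × B × C → ℂ) × Matrix C C ℂ) :=
    {p | 0 ≤ (1 : Matrix A A ℂ) ⊗ₖ p.2 - operatorAC p.1 * (operatorAC p.1)ᴴ}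
  set S := (vectorBall ε ψ ×ˢ {ω : Matrix C C ℂ | 0 ≤ ω ∧ ω.trace.re ≤ q}) ∩ F
  have hcont : Continuous fun p : (A × B × C → ℂ) × Matrix C C ℂ =>
      (1 : Matrix A A ℂ) ⊗ₖ p.2 - operatorAC p.1 * (operatorAC p.1)ᴴ := by
    have h1 : Continuous fun p : (A × B × C → ℂ) × Matrix C C ℂ => operatorAC p.1 :=
      continuous_matrix fun i j => by
        simp only [operatorAC, of_apply]
        fun_prop
    refine Continuous.sub (continuous_matrix fun i j => ?_) (h1.matrix_mul h1.matrix_conjTranspose)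
    simp only [kroneckerMap_apply]
    exact continuous_const.mul ((continuous_snd).matrix_elem _ _)
  have hF : IsClosed F := isClosed_nonneg.preimage hcont
  have hS : IsCompact S :=
    ((isCompact_vectorBall ε ψ).prod (isCompact_nonneg_trace_le q)).inter_right hF
  have h0 : 0 ≤ t • (1 : Matrix C C ℂ) := smul_nonneg ht zero_le_one
  have hne : S.Nonempty := by
    refine ⟨(ψ, t • 1), ⟨self_mem_vectorBall ε hψ, h0, le_rfl⟩, ?_⟩
    show 0 ≤ (1 : Matrix A A ℂ) ⊗ₖ (t • (1 : Matrix C C ℂ)) - _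
    rw [sub_nonneg, kronecker_smul, one_kronecker_one]
    exact hle
  obtain ⟨⟨φ, ω⟩, ⟨⟨hφ, hω0, hωq⟩, hωF⟩, hmin⟩ := hS.exists_isMinOn hne
    (f := fun p => p.2.trace.re)
    (Complex.continuous_re.comp (by fun_prop : Continuous fun p : (A × B × C → ℂ) × Matrix C C ℂ =>
      p.2.trace)).continuousOn
  refine ⟨φ, hφ, ω, hω0, sub_nonneg.mp hωF, fun φ' hφ' ω' hω' hle' => ?_⟩
  by_cases hq : ω'.trace.re ≤ q
  · exact hmin (a := (φ', ω')) ⟨⟨hφ', hω', hq⟩, sub_nonneg.mpr hle'⟩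
  · exact le_trans hωq (not_le.mp hq).le

variable [DecidableEq B]

lemma operatorAB_mem_ball {ε : ℝ} (hε : 0 ≤ ε) {φ ψ : A × B × C → ℂ} (h : φ ∈ vectorBall ε ψ) :
    operatorAB φ * (operatorAB φ)ᴴ ∈ ball ε (operatorAB ψ * (operatorAB ψ)ᴴ) := by
  refine mem_ball_of_trace_le hε ?_ ?_
  · rw [trace_mul_comm, trace_operatorAB]
    exact h.1
  · rw [trace_mul_comm (operatorAB φ), trace_mul_comm (operatorAB ψ), trace_operatorAB,
      trace_operatorAB, trace_operatorAB]
    exact h.2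

lemma operatorAC_mem_ball {ε : ℝ} (hε : 0 ≤ ε) {φ ψ : A × B × C → ℂ} (h : φ ∈ vectorBall ε ψ) :
    operatorAC φ * (operatorAC φ)ᴴ ∈ ball ε (operatorAC ψ * (operatorAC ψ)ᴴ) := by
  refine mem_ball_of_trace_le hε ?_ ?_
  · rw [trace_mul_comm, trace_operatorAC]
    exact h.1
  · rw [trace_mul_comm (operatorAC φ), trace_mul_comm (operatorAC ψ), trace_operatorAC,
      trace_operatorAC, trace_operatorAC]
    exact h.2

lemma exists_operatorAC_le_of_mem_ball {ε : ℝ} (hε : 0 ≤ ε) {ψ : A × B × C → ℂ}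
    (hψ : (star ψ ⬝ᵥ ψ).re ≤ 1) {τ : Matrix (A × C) (A × C) ℂ}
    (hτ : τ ∈ ball ε (operatorAC ψ * (operatorAC ψ)ᴴ)) :
    ∃ φ ∈ vectorBall ε ψ, operatorAC φ * (operatorAC φ)ᴴ ≤ τ := by
  obtain ⟨N, hle, h1, h2, -⟩ := exists_trace_le_of_mem_ball hε
    (by rw [trace_mul_comm, trace_operatorAC]; exact hψ) hτ
  obtain ⟨φ, rfl⟩ := operatorAC_surjective N
  refine ⟨φ, ⟨?_, ?_⟩, hle⟩
  · rwa [trace_mul_comm, trace_operatorAC] at h1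
  · rwa [trace_mul_comm (operatorAC φ), trace_mul_comm (operatorAC ψ), trace_operatorAC,
      trace_operatorAC, trace_operatorAC] at h2

lemma exists_Hmax_operatorAB_le_of_mem_ball {b ε : ℝ} (hb : 1 < b) (hε : 0 ≤ ε)
    {ψ : A × B × C → ℂ} (hψ : (star ψ ⬝ᵥ ψ).re ≤ 1) {τ : Matrix (A × B) (A × B) ℂ}
    (hτ : τ ∈ ball ε (operatorAB ψ * (operatorAB ψ)ᴴ)) :
    ∃ φ ∈ vectorBall ε ψ, Hmax b (operatorAB φ * (operatorAB φ)ᴴ) ≤ Hmax b τ := by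
  obtain ⟨N, -, h1, h2, hF⟩ := exists_trace_le_of_mem_ball hε
    (by rw [trace_mul_comm, trace_operatorAB]; exact hψ) hτ
  obtain ⟨φ, rfl⟩ := operatorAB_surjective N
  refine ⟨φ, ⟨?_, ?_⟩, ?_⟩
  · rwa [trace_mul_comm, trace_operatorAB] at h1
  · rwa [trace_mul_comm (operatorAB φ), trace_mul_comm (operatorAB ψ), trace_operatorAB,
      trace_operatorAB, trace_operatorAB] at h2
  · rw [← EReal.le_of_forall_lt_iff_le]
    intro l hl
    rw [Hmax_le_iff hb]
    intro σ hσ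
    refine le_trans ?_ ((Hmax_le_iff hb _ _).mp hl.le σ hσ)
    exact pow_le_pow_left₀ (rootFidelity_nonneg _ _)
      (hF _ (PosSemidef.one.kronecker hσ.1).nonneg) 2

end Vectors

end SmoothEntropy

/-! ### Smooth duality -/

open SmoothEntropy Matrix in
/-- The smooth entropies are attained (as a minimum and a maximum over the ball), are finite, and
satisfy the duality relation. -/
theorem mainTheorem7 {A B C : Type*} [Fintype A] [Fintype B] [Fintype C]
    [DecidableEq A] [DecidableEq B] [DecidableEq C]
    (b : ℝ) (hb : 1 < b)
    (ρ : Matrix (A × B × C) (A × B × C) ℂ) (hρ : SmoothEntropy.IsPure ρ)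
    (ε : ℝ) (hε : 0 ≤ ε) (hε' : ε < √(ρ.trace.re)) :
    SmoothEntropy.smoothHmax b ε (SmoothEntropy.marginalAB ρ)
        = -SmoothEntropy.smoothHmin b ε (SmoothEntropy.marginalAC ρ) ∧
      (∃ τ ∈ SmoothEntropy.ball ε (SmoothEntropy.marginalAB ρ),
        SmoothEntropy.Hmax b τ = SmoothEntropy.smoothHmax b ε (SmoothEntropy.marginalAB ρ)) ∧
      (∃ τ ∈ SmoothEntropy.ball ε (SmoothEntropy.marginalAC ρ),
        SmoothEntropy.Hmin b τ = SmoothEntropy.smoothHmin b ε (SmoothEntropy.marginalAC ρ)) ∧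
      ∃ h : ℝ, SmoothEntropy.smoothHmax b ε (SmoothEntropy.marginalAB ρ) = (h : EReal) := by
  have hb0 : 0 < b := by linarith
  obtain ⟨⟨hpos, htr⟩, hrank⟩ := hρ
  obtain ⟨ψ, rfl⟩ := exists_eq_vecMulVec_of_rank_eq_one hpos hrank
  rw [trace_vecMulVec, dotProduct_comm] at htr hε'
  rw [marginalAB_vecMulVec, marginalAC_vecMulVec]
  obtain ⟨φ, hφ, ω, hω, hle, hmin⟩ := exists_minimal_trace ε htr
  -- Zero trace would force `ω = 0` and hence `φ = 0`; positivity makes the logarithm of the optimal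
  -- trace finite.
  have hp : 0 < ω.trace.re := by
    obtain h | h := (trace_re_nonneg hω).lt_or_eq
    · exact h
    exfalso
    have h0 : ω = 0 := hω.posSemidef.trace_eq_zero_iff.mp
      (Complex.ext h.symm (Complex.le_def.mp hω.posSemidef.trace_nonneg).2.symm)
    rw [h0, kronecker_zero] at hle
    have h1 := le_antisymm hle (posSemidef_self_mul_conjTranspose _).nonneg
    have h2 := operatorAC_eq_zero (self_mul_conjTranspose_eq_zero.mp h1)
    exact zero_notMem_vectorBall hε htr hε' (h2 ▸ hφ)
  set h : ℝ := Real.logb b ω.trace.re with hh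
  have hbh : b ^ h = ω.trace.re := Real.rpow_logb hb0 hb.ne' hp
  have hminle : ∀ τ ∈ ball ε (operatorAC ψ * (operatorAC ψ)ᴴ), Hmin b τ ≤ ((-h : ℝ) : EReal) := by
    intro τ hτ
    refine Hmin_le hb fun ω' l hω' hl hle' => ?_
    obtain ⟨φ', hφ', hφτ⟩ := exists_operatorAC_le_of_mem_ball hε htr hτ
    -- A certificate `ω'` for `τ` also certifies the marginal of `φ'` below it, so minimality of `tr
    -- ω` applies.
    have h1 := (hmin φ' hφ' ω' hω' (hφτ.trans hle')).trans hl
    rw [← Real.logb_le_iff_le_rpow hb hp] at h1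
    exact_mod_cast le_neg_of_le_neg h1
  have hminφ : Hmin b (operatorAC φ * (operatorAC φ)ᴴ) = ((-h : ℝ) : EReal) :=
    le_antisymm (hminle _ (operatorAC_mem_ball hε hφ))
      (le_Hmin hb hω hle (by rw [neg_neg, hbh]))
  have hmaxφ : Hmax b (operatorAB φ * (operatorAB φ)ᴴ) = (h : EReal) := by
    rw [Hmax_operatorAB_eq_neg_Hmin_operatorAC hb, hminφ, ← EReal.coe_neg, neg_neg]
  have hsmin : smoothHmin b ε (operatorAC ψ * (operatorAC ψ)ᴴ) = ((-h : ℝ) : EReal) :=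
    le_antisymm (iSup₂_le hminle)
      (hminφ ▸ le_iSup₂_of_le (f := fun τ (_ : τ ∈ ball ε (operatorAC ψ * (operatorAC ψ)ᴴ)) =>
        Hmin b τ) _ (operatorAC_mem_ball hε hφ) le_rfl)
  have hsmax : smoothHmax b ε (operatorAB ψ * (operatorAB ψ)ᴴ) = (h : EReal) := by
    refine le_antisymm ?_ (le_iInf₂ fun τ hτ => ?_)
    · rw [← hmaxφ]
      exact iInf₂_le_of_le (f := fun τ (_ : τ ∈ ball ε (operatorAB ψ * (operatorAB ψ)ᴴ)) =>
        Hmax b τ) _ (operatorAB_mem_ball hε hφ) le_rfl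
    -- Duality at `φ'` carries the bound `hminle` over from the `AC` ball.
    · obtain ⟨φ', hφ', hφτ⟩ := exists_Hmax_operatorAB_le_of_mem_ball hb hε htr hτ
      refine le_trans ?_ hφτ
      rw [Hmax_operatorAB_eq_neg_Hmin_operatorAC hb, EReal.le_neg, ← EReal.coe_neg]
      exact hminle _ (operatorAC_mem_ball hε hφ')
  refine ⟨?_, ⟨_, operatorAB_mem_ball hε hφ, hmaxφ.trans hsmax.symm⟩,
    ⟨_, operatorAC_mem_ball hε hφ, hminφ.trans hsmin.symm⟩, h, hsmax⟩
  rw [hsmax, hsmin, ← EReal.coe_neg, neg_neg]
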